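/- Let $0<\alpha<1$ and $T>0$. For $y:[0,T]\to\mathbb{R}$ let $$y^{(\alpha)}(x)=\frac{1}{\Gamma(1-\alpha)}\int_0^x\frac{y'(\xi)}{(x-\xi)^{\alpha}}\,d\xi$$ be the Caputo derivative of order $\alpha$ with lower limit $0$. Let $y\in C^3[0,T]$ be a solution of $$y^{(\alpha)}(x)+y(x)=f(x)\qquad(0\le x\le T)$$ with $y(0)=y'(0)=y''(0)=0$ (one-sided derivatives at $0$). Put $w_k^{(\alpha)}=(-1)^k\binom{\alpha}{k}$ and, for a positive integer $N$, $h=T/N$ and $x_n=nh$. Let $\widetilde y_0,\dots,\widetilde y_N$ be defined by $\widetilde y_0=0$ and, for $1\le n\le N$, by either of the recurrences $$\widetilde{y}_n=\frac{1}{1+\left(1-\frac{\alpha}{2}\right)h^\alpha}\left(h^\alpha f\!\left(\left(n-\tfrac{\alpha}{2}\right)h\right)+\frac{\alpha}{2}\left(2-h^\alpha\right)\widetilde{y}_{n-1}-\sum_{k=2}^n w_k^{(\alpha)}\widetilde{y}_{n-k}\right),$$ $$\widetilde{y}_n=\frac{1}{1+\left(1-\frac{\alpha}{2}\right)h^\alpha}\left(h^\alpha\left(\left(1-\frac{\alpha}{2}\right)f(x_n)+\frac{\alpha}{2}f(x_{n-1})\right)+\frac{\alpha}{2}\left(2-h^\alpha\right)\widetilde{y}_{n-1}-\sum_{k=2}^n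 w_k^{(\alpha)}\widetilde{y}_{n-k}\right).$$ Then both approximations converge to the solution with accuracy $O(h^2)$: there is a constant $C$, independent of $N$ and $n$ (it may depend on $\alpha$, $T$, $f$ and $y$), such that, for each of the two recurrences, $|y(x_n)-\widetilde y_n|\le C h^2$ for all $N\ge 1$ and all $0\le n\le N$. -/

import Mathlib

/-- The Caputo fractional derivative of order `α` (for `0 < α < 1`) with lower limit `b`:
`(1 / Γ(1 - α)) ∫_b^x y'(ξ) (x - ξ)^(-α) dξ`. Only the values of `y` between `b` and `x` matter:
the two end points, where `deriv y` is a two-sided derivative, form a null set. -/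
noncomputable def caputoDeriv (b α : ℝ) (y : ℝ → ℝ) (x : ℝ) : ℝ :=
  1 / Real.Gamma (1 - α) * ∫ ξ in b..x, deriv y ξ / (x - ξ) ^ α

/-- `y` is a solution on `[0, T]` of the equation `y^(α)(x) + y(x) = f(x)`, where `y^(α)` is the
Caputo derivative with lower limit `0`. -/
def IsFracSolution (α T : ℝ) (f y : ℝ → ℝ) : Prop :=
  ∀ x ∈ Set.Icc (0 : ℝ) T, caputoDeriv 0 α y x + y x = f x

/-- The Grünwald weights `w_k = (-1)^k (α choose k)`, with the generalized binomial coefficient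
`α (α - 1) ⋯ (α - k + 1) / k!`. -/
noncomputable def grunwaldWeight (α : ℝ) (k : ℕ) : ℝ :=
  (-1) ^ k * Ring.choose α k

/-- `u 0, …, u N` are computed with step `h` by the recurrence relations that evaluate the right-hand
side `f` at the intermediate points `(n - α/2) h`. -/
def IsMidpointScheme (α h : ℝ) (f : ℝ → ℝ) (N : ℕ) (u : ℕ → ℝ) : Prop :=
  u 0 = 0 ∧ ∀ n : ℕ, 1 ≤ n → n ≤ N →
    u n = 1 / (1 + (1 - α / 2) * h ^ α) *
      (h ^ α * f (((n : ℝ) - α / 2) * h) + α / 2 * (2 - h ^ α) * u (n - 1)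
        - ∑ k ∈ Finset.Icc 2 n, grunwaldWeight α k * u (n - k))

/-- `u 0, …, u N` are computed with step `h` by the recurrence relations that use the weighted
average `(1 - α/2) f(n h) + (α/2) f((n - 1) h)` of the right-hand side `f` at the grid points. -/
def IsAverageScheme (α h : ℝ) (f : ℝ → ℝ) (N : ℕ) (u : ℕ → ℝ) : Prop :=
  u 0 = 0 ∧ ∀ n : ℕ, 1 ≤ n → n ≤ N →
    u n = 1 / (1 + (1 - α / 2) * h ^ α) *
      (h ^ α * ((1 - α / 2) * f ((n : ℝ) * h) + α / 2 * f (((n : ℝ) - 1) * h))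
        + α / 2 * (2 - h ^ α) * u (n - 1)
        - ∑ k ∈ Finset.Icc 2 n, grunwaldWeight α k * u (n - k))

/-! Stability plus consistency. The weights `w_k` with `k ≥ 1` are nonpositive and all partial sums
are positive, so a maximum-type induction bounds the error by the largest residual divided by `1 -
α`, with no restriction on the step (`abs_le_of_grunwald_recurrence`).

For consistency, let `g = y'''`. The vanishing initial data turn `y` and its Caputo derivative into
convolutions of `g` with `t ^ 2 / 2` and `t ^ (2 - α) / Γ(3 - α)`. The error of the Grünwald
quotient at the shifted point `(n - α/2) h` is then `h ^ (2 - α)` times the integral of `Φ((x_n - s)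
/ h) * g s`, where `Φ` is a combination of truncated powers. If `|Φ τ| ≤ c * τ ^ (-α)`, rescaling
returns the missing `h ^ α`, and integrability of `t ^ (-α)` gives `O(h ^ 2)`. Linear interpolation
between grid points is treated in the same way.

The core is this decay (`exists_abs_grunwald_kernel_le`). On the integer cell `m = ⌊τ⌋₊` the sum in
`Φ` is `grunwaldSum α m` times a quadratic, and `Γ(1 - α) * grunwaldSum α m = X ^ (-α) * (1 + O(X ^
(-2)))` with `X = m + (1 - α) / 2` (`exists_abs_grunwaldSum_sub_le`). Expanding `(τ - α/2) ^ (2 -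
α)` about `X` cancels the two leading orders; the shift `α/2` is what makes the second one cancel.
-/

/-! ### Grünwald weights: recurrences, signs, closed forms of partial moments -/

/-- The partial sums `w_0 + ⋯ + w_m` of the Grünwald weights. -/
noncomputable def grunwaldSum (α : ℝ) (m : ℕ) : ℝ :=
  ∑ k ∈ Finset.range (m + 1), grunwaldWeight α k

theorem grunwaldWeight_zero (α : ℝ) : grunwaldWeight α 0 = 1 := by
  simp [grunwaldWeight]

theorem choose_succ_mul (α : ℝ) (k : ℕ) :
    ((k : ℝ) + 1) * Ring.choose α (k + 1) = (α - k) * Ring.choose α k := by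
  have h1 := Ring.descPochhammer_eq_factorial_smul_choose α (k + 1)
  have h0 := Ring.descPochhammer_eq_factorial_smul_choose α k
  have hs : (descPochhammer ℤ (k + 1)).smeval α = (descPochhammer ℤ k).smeval α * (α - k) := by
    rw [descPochhammer_succ_right, Polynomial.smeval_mul, Polynomial.smeval_sub,
      Polynomial.smeval_X, Polynomial.smeval_natCast]
    simp
  rw [h1, h0, Nat.factorial_succ] at hs
  simp only [nsmul_eq_mul] at hs
  push_cast at hs
  have hk : (k.factorial : ℝ) ≠ 0 := by positivity
  apply mul_left_cancel₀ hk
  linear_combination hs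

theorem succ_mul_grunwaldWeight_succ (α : ℝ) (k : ℕ) :
    ((k : ℝ) + 1) * grunwaldWeight α (k + 1) = (k - α) * grunwaldWeight α k := by
  have := choose_succ_mul α k
  simp only [grunwaldWeight, pow_succ]
  linear_combination -(-1) ^ k * this

theorem grunwaldWeight_one (α : ℝ) : grunwaldWeight α 1 = -α := by
  simpa [grunwaldWeight_zero] using succ_mul_grunwaldWeight_succ α 0

theorem grunwaldSum_zero (α : ℝ) : grunwaldSum α 0 = 1 := by
  simp [grunwaldSum, grunwaldWeight_zero]

theorem grunwaldSum_succ (α : ℝ) (m : ℕ) :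
    grunwaldSum α (m + 1) = grunwaldSum α m + grunwaldWeight α (m + 1) := by
  rw [grunwaldSum, Finset.sum_range_succ, grunwaldSum]

/-- The partial sums are themselves Grünwald weights, of order `α - 1`. Hence they obey a
first-order recurrence, and the partial moments below are explicit multiples of `grunwaldSum α m`.
-/
theorem succ_mul_grunwaldWeight_succ_eq_sum (α : ℝ) (m : ℕ) :
    ((m : ℝ) + 1) * grunwaldWeight α (m + 1) = -α * grunwaldSum α m := by
  induction m with
  | zero => simp [grunwaldSum_zero, grunwaldWeight_one]
  | succ m ih =>
    have := succ_mul_grunwaldWeight_succ α (m + 1)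
    rw [grunwaldSum_succ]
    push_cast at this ⊢
    linear_combination this + ih

theorem succ_mul_grunwaldSum_succ (α : ℝ) (m : ℕ) :
    ((m : ℝ) + 1) * grunwaldSum α (m + 1) = (m + 1 - α) * grunwaldSum α m := by
  rw [grunwaldSum_succ]
  linear_combination succ_mul_grunwaldWeight_succ_eq_sum α m

theorem grunwaldSum_pos {α : ℝ} (h1 : α < 1) (m : ℕ) : 0 < grunwaldSum α m := by
  induction m with
  | zero => simp [grunwaldSum_zero]
  | succ m ih =>
    have h := succ_mul_grunwaldSum_succ α m
    have hm : (0 : ℝ) < (m : ℝ) + 1 := by positivity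
    have : 0 < ((m : ℝ) + 1 - α) * grunwaldSum α m := by
      apply mul_pos _ ih
      have : (0 : ℝ) ≤ m := by positivity
      linarith
    rw [← h] at this
    exact pos_of_mul_pos_right this hm.le

theorem grunwaldWeight_succ_nonpos {α : ℝ} (h0 : 0 < α) (h1 : α < 1) (m : ℕ) :
    grunwaldWeight α (m + 1) ≤ 0 := by
  have h := succ_mul_grunwaldWeight_succ_eq_sum α m
  have := mul_pos h0 (grunwaldSum_pos h1 m)
  have hm : (0 : ℝ) < (m : ℝ) + 1 := by positivity
  by_contra hc
  push Not at hc
  nlinarith [mul_pos hm hc]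

theorem sum_mul_grunwaldWeight {α : ℝ} (h1 : α < 1) (m : ℕ) :
    ∑ k ∈ Finset.range (m + 1), (k : ℝ) * grunwaldWeight α k
      = -α * m * grunwaldSum α m / (1 - α) := by
  have h : 1 - α ≠ 0 := by linarith
  induction m with
  | zero => simp
  | succ m ih =>
    rw [Finset.sum_range_succ, ih]
    have e1 := succ_mul_grunwaldSum_succ α m
    have e2 := succ_mul_grunwaldWeight_succ_eq_sum α m
    push_cast
    rw [e2]
    field_simp
    linear_combination α * e1

theorem sum_sq_mul_grunwaldWeight {α : ℝ} (h1 : α < 1) (m : ℕ) :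
    ∑ k ∈ Finset.range (m + 1), (k : ℝ) ^ 2 * grunwaldWeight α k
      = -α * grunwaldSum α m * (m * (m - 1) / (2 - α) + m / (1 - α)) := by
  have h : 1 - α ≠ 0 := by linarith
  have h2 : 2 - α ≠ 0 := by linarith
  induction m with
  | zero => simp
  | succ m ih =>
    rw [Finset.sum_range_succ, ih]
    have e1 := succ_mul_grunwaldSum_succ α m
    have e2 := succ_mul_grunwaldWeight_succ_eq_sum α m
    push_cast
    have e3 : ((m : ℝ) + 1) ^ 2 * grunwaldWeight α (m + 1)
      = (m + 1) * (-α * grunwaldSum α m) := by rw [← e2]; ring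
    rw [e3]
    field_simp
    linear_combination (α * ((1 - α) * m + (2 - α))) * e1

theorem grunwaldSum_eq_one_sub {α : ℝ} {n : ℕ} (hn : 1 ≤ n) :
    grunwaldSum α n = 1 - α + ∑ k ∈ Finset.Icc 2 n, grunwaldWeight α k := by
  induction n, hn using Nat.le_induction with
  | base => simp [grunwaldSum_succ, grunwaldSum_zero, grunwaldWeight_one]; ring
  | succ n hn ih =>
    rw [grunwaldSum_succ, ih, Finset.sum_Icc_succ_top (by omega)]
    ring

theorem sum_grunwaldWeight_mul_eq {α : ℝ} {n : ℕ} (hn : 1 ≤ n) (v : ℕ → ℝ) :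
    ∑ k ∈ Finset.range (n + 1), grunwaldWeight α k * v k
      = v 0 - α * v 1 + ∑ k ∈ Finset.Icc 2 n, grunwaldWeight α k * v k := by
  induction n, hn using Nat.le_induction with
  | base => simp [Finset.sum_range_succ, grunwaldWeight_zero, grunwaldWeight_one]; ring
  | succ n hn ih =>
    rw [Finset.sum_range_succ, ih, Finset.sum_Icc_succ_top (by omega)]
    ring

/-! ### Stability -/

/-- Stability of the implicit scheme, uniformly in the step size. -/
theorem abs_le_of_grunwald_recurrence {α H ε : ℝ} (h0 : 0 < α) (h1 : α < 1) (hH : 0 < H)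
    (hε : 0 ≤ ε) {N : ℕ} {e ρ : ℕ → ℝ} (he0 : e 0 = 0)
    (hρ : ∀ n, 1 ≤ n → n ≤ N → |ρ n| ≤ ε)
    (he : ∀ n, 1 ≤ n → n ≤ N → (1 + (1 - α / 2) * H) * e n
      = α / 2 * (2 - H) * e (n - 1) - ∑ k ∈ Finset.Icc 2 n, grunwaldWeight α k * e (n - k)
        + H * ρ n) (n : ℕ) (hn : n ≤ N) : |e n| ≤ ε / (1 - α) := by
  have h1' : 0 < 1 - α := by linarith
  set E := ε / (1 - α) with hE
  have hE0 : 0 ≤ E := by positivity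
  have hEε : ε = (1 - α) * E := by rw [hE]; field_simp
  induction n using Nat.strong_induction_on with
  | _ n ih =>
    rcases Nat.eq_zero_or_pos n with rfl | hpos
    · simpa [he0] using hE0
    have hsum : |∑ k ∈ Finset.Icc 2 n, grunwaldWeight α k * e (n - k)| ≤ (1 - α) * E := by
      calc _ ≤ ∑ k ∈ Finset.Icc 2 n, |grunwaldWeight α k * e (n - k)| :=
            Finset.abs_sum_le_sum_abs _ _
        _ ≤ ∑ k ∈ Finset.Icc 2 n, (-grunwaldWeight α k) * E := by
            refine Finset.sum_le_sum fun k hk ↦ ?_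
            rw [Finset.mem_Icc] at hk
            obtain ⟨j, rfl⟩ : ∃ j, k = j + 1 := ⟨k - 1, by omega⟩
            have hw := grunwaldWeight_succ_nonpos h0 h1 j
            rw [abs_mul, abs_of_nonpos hw]
            exact mul_le_mul_of_nonneg_left (ih _ (by omega) (by omega)) (by linarith)
        _ = (-∑ k ∈ Finset.Icc 2 n, grunwaldWeight α k) * E := by
            rw [← Finset.sum_mul, Finset.sum_neg_distrib]
        _ ≤ _ := by
            apply mul_le_mul_of_nonneg_right _ hE0
            -- The absolute values of the weights from `k = 2` on add up to `1 - α - grunwaldSum α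
            -- n`, which is less than `1 - α`.
            have a := grunwaldSum_eq_one_sub (α := α) hpos
            have b := grunwaldSum_pos h1 n
            linarith
    have hprev := ih (n - 1) (by omega) (by omega)
    have hr := hρ n hpos hn
    have hc : 0 < 1 + (1 - α / 2) * H := by nlinarith
    have hHr : |H * ρ n| ≤ H * ((1 - α) * E) := by
      rw [abs_mul, abs_of_pos hH, ← hEε]
      exact mul_le_mul_of_nonneg_left hr hH.le
    have hmid : |α / 2 * (2 - H) * e (n - 1)| ≤ |α / 2 * (2 - H)| * E := by
      rw [abs_mul]
      exact mul_le_mul_of_nonneg_left hprev (abs_nonneg _)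
    -- Both signs of `2 - H` are admissible, so large steps need no separate treatment.
    have hcoef : |α / 2 * (2 - H)| + (1 - α) + H * (1 - α) ≤ 1 + (1 - α / 2) * H := by
      rcases abs_cases (α / 2 * (2 - H)) with ⟨h, _⟩ | ⟨h, _⟩ <;> rw [h] <;>
        nlinarith [mul_pos h0 hH]
    have htot : |(1 + (1 - α / 2) * H) * e n| ≤ (1 + (1 - α / 2) * H) * E := by
      rw [he n hpos hn]
      calc _ ≤ |α / 2 * (2 - H) * e (n - 1)|
            + |∑ k ∈ Finset.Icc 2 n, grunwaldWeight α k * e (n - k)| + |H * ρ n| :=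
            (abs_add_le _ _).trans (add_le_add_left (abs_sub _ _) _)
        _ ≤ (|α / 2 * (2 - H)| + (1 - α) + H * (1 - α)) * E := by linarith
        _ ≤ _ := mul_le_mul_of_nonneg_right hcoef hE0
    rw [abs_mul, abs_of_pos hc] at htot
    exact le_of_mul_le_mul_left htot hc

/-! ### Asymptotics of the partial sums -/

/-- A quantitative form of the convexity of `2 artanh x = log (1 + x) - log (1 - x)`. -/
theorem mul_log_sub_log_sub_bounds {a x : ℝ} (ha0 : 0 ≤ a) (ha1 : a ≤ 1) (hx0 : 0 ≤ x)
    (hx1 : x < 1) :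
    0 ≤ a * (Real.log (1 + x) - Real.log (1 - x))
        - (Real.log (1 + a * x) - Real.log (1 - a * x)) ∧
      a * (Real.log (1 + x) - Real.log (1 - x))
        - (Real.log (1 + a * x) - Real.log (1 - a * x)) ≤ x ^ 3 / (1 - x ^ 2) := by
  have hax : a * x < 1 := by nlinarith
  have s1 := (Real.hasSum_log_sub_log_of_abs_lt_one (by rwa [abs_of_nonneg hx0])).mul_left a
  have s2 := Real.hasSum_log_sub_log_of_abs_lt_one
    (by rwa [abs_of_nonneg (mul_nonneg ha0 hx0)] : |a * x| < 1)
  have s := s1.sub s2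
  -- The linear terms of the two series cancel, so the tail from index `1`, of order `x ^ 3`, is
  -- everything.
  have s' := (hasSum_nat_add_iff' 1).2 s
  have hpow : ∀ k : ℕ, a ^ (2 * k + 1) ≤ a := fun k ↦ pow_le_of_le_one ha0 ha1 (by omega)
  constructor
  · refine s.nonneg fun k ↦ ?_
    rw [mul_pow]
    have h1 : 0 ≤ 2 * (1 / (2 * (k : ℝ) + 1)) * x ^ (2 * k + 1) := by positivity
    nlinarith [mul_nonneg h1 (sub_nonneg.2 (hpow k))]
  · have hx2 : x ^ 2 < 1 := by nlinarith
    have g := (hasSum_geometric_of_lt_one (sq_nonneg x) hx2).mul_left (x ^ 3)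
    have := hasSum_le (fun k ↦ ?_) s' g
    · rw [← div_eq_mul_inv] at this
      refine le_trans (le_of_eq ?_) this
      simp only [Finset.range_one, Finset.sum_singleton]
      push_cast
      ring
    · have e : x ^ 3 * (x ^ 2) ^ k = x ^ (2 * (k + 1) + 1) := by rw [← pow_mul, ← pow_add]; congr 1; ring
      rw [e, mul_pow]
      have hxp : 0 ≤ x ^ (2 * (k + 1) + 1) := by positivity
      have hc : 2 * (1 / (2 * ((k + 1 : ℕ) : ℝ) + 1)) ≤ 1 := by
        rw [mul_one_div, div_le_one (by positivity)]
        push_cast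
        have : (0 : ℝ) ≤ k := by positivity
        linarith
      have hc0 : 0 ≤ 2 * (1 / (2 * ((k + 1 : ℕ) : ℝ) + 1)) := by positivity
      have hp0 : 0 ≤ a ^ (2 * (k + 1) + 1) := by positivity
      have hd : a - a ^ (2 * (k + 1) + 1) ≤ 1 := by linarith
      have hd0 : 0 ≤ a - a ^ (2 * (k + 1) + 1) := by linarith [hpow (k + 1)]
      calc _ = (2 * (1 / (2 * ((k + 1 : ℕ) : ℝ) + 1))) * (a - a ^ (2 * (k + 1) + 1))
              * x ^ (2 * (k + 1) + 1) := by ring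
        _ ≤ 1 * x ^ (2 * (k + 1) + 1) := by
            apply mul_le_mul_of_nonneg_right _ hxp
            calc _ ≤ (1 : ℝ) * 1 := mul_le_mul hc hd hd0 zero_le_one
              _ = 1 := one_mul 1
        _ = _ := one_mul _

/-- The logarithm of `(w_0 + ⋯ + w_m) (m + (1 - α) / 2) ^ α`. -/
noncomputable def logGrunwaldSum (α : ℝ) (m : ℕ) : ℝ :=
  Real.log (grunwaldSum α m) + α * Real.log (m + (1 - α) / 2)

/-- The ratio of consecutive partial sums is `(m + 1 - α) / (m + 1)`. Its two terms, and also the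
consecutive values of `m + (1 - α) / 2`, are symmetric about `Z = m + 1 - α / 2`. This symmetry
leaves only odd functions of `x`; it is the reason for the offset `(1 - α) / 2`. -/
theorem logGrunwaldSum_succ_sub {α : ℝ} (h0 : 0 < α) (h1 : α < 1) (m : ℕ) {x : ℝ}
    (hx : x = 1 / (2 * (m + 1 - α / 2))) :
    logGrunwaldSum α (m + 1) - logGrunwaldSum α m
      = α * (Real.log (1 + x) - Real.log (1 - x))
        - (Real.log (1 + α * x) - Real.log (1 - α * x)) := by
  have hm : (0 : ℝ) ≤ m := by positivity
  set Z : ℝ := m + 1 - α / 2 with hZ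
  have hZ0 : 0 < Z := by linarith
  have hZx : Z * x = 1 / 2 := by rw [hx]; field_simp
  have a1 : 1 + x = (m + 1 + (1 - α) / 2) / Z := by
    rw [eq_div_iff hZ0.ne']; linear_combination hZx + hZ
  have a2 : 1 - x = (m + (1 - α) / 2) / Z := by
    rw [eq_div_iff hZ0.ne']; linear_combination -hZx + hZ
  have a3 : 1 + α * x = (m + 1) / Z := by
    rw [eq_div_iff hZ0.ne']; linear_combination α * hZx + hZ
  have a4 : 1 - α * x = (m + 1 - α) / Z := by
    rw [eq_div_iff hZ0.ne']; linear_combination -α * hZx + hZ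
  have hW := grunwaldSum_pos h1 m
  have e : grunwaldSum α (m + 1) = (m + 1 - α) / (m + 1) * grunwaldSum α m := by
    rw [div_mul_eq_mul_div, eq_div_iff (by positivity), mul_comm]
    exact succ_mul_grunwaldSum_succ α m
  have p1 : (m : ℝ) + 1 - α ≠ 0 := by linarith
  have p2 : (m : ℝ) + 1 ≠ 0 := by linarith
  have p3 : (m : ℝ) + (1 - α) / 2 ≠ 0 := by linarith
  have p4 : (m : ℝ) + 1 + (1 - α) / 2 ≠ 0 := by linarith
  rw [a1, a2, a3, a4, Real.log_div p4 hZ0.ne', Real.log_div p3 hZ0.ne', Real.log_div p2 hZ0.ne',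
    Real.log_div p1 hZ0.ne', logGrunwaldSum, logGrunwaldSum, e,
    Real.log_mul (div_ne_zero p1 p2) hW.ne', Real.log_div p1 p2]
  push_cast
  ring

/-- Expresses the denominator of Euler's sequence for `Γ(1 - α)` through the partial sums, which
identifies the limit below. -/
theorem prod_one_sub_add_eq (α : ℝ) (m : ℕ) :
    ∏ j ∈ Finset.range (m + 1), (1 - α + j) = m.factorial * grunwaldSum α m * (m + 1 - α) := by
  induction m with
  | zero => simp [grunwaldSum_zero]
  | succ m ih =>
    rw [Finset.prod_range_succ, ih, Nat.factorial_succ]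
    have := succ_mul_grunwaldSum_succ α m
    push_cast
    linear_combination (-m.factorial * (m + 2 - α)) * this

open Filter Topology in
theorem tendsto_logGrunwaldSum {α : ℝ} (h1 : α < 1) :
    Tendsto (logGrunwaldSum α) atTop (𝓝 (-Real.log (Real.Gamma (1 - α)))) := by
  have hG : 0 < Real.Gamma (1 - α) := Real.Gamma_pos_of_pos (by linarith)
  have t0 := ((Real.continuousAt_log hG.ne').tendsto.comp
    (Real.GammaSeq_tendsto_Gamma (1 - α))).neg
  have q1 : Tendsto (fun m : ℕ ↦ 1 + (1 - α) / 2 * ((m : ℝ)⁻¹)) atTop (𝓝 1) := by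
    simpa using (tendsto_inv_atTop_nhds_zero_nat (𝕜 := ℝ)).const_mul ((1 - α) / 2) |>.const_add 1
  have q2 : Tendsto (fun m : ℕ ↦ 1 + (1 - α) * ((m : ℝ)⁻¹)) atTop (𝓝 1) := by
    simpa using (tendsto_inv_atTop_nhds_zero_nat (𝕜 := ℝ)).const_mul (1 - α) |>.const_add 1
  have l1 := (((Real.continuousAt_log one_ne_zero).tendsto.comp q1).const_mul α)
  have l2 := ((Real.continuousAt_log one_ne_zero).tendsto.comp q2)
  have t := (t0.add l1).sub l2
  rw [Real.log_one, mul_zero, add_zero, sub_zero] at t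
  refine t.congr' ?_
  filter_upwards [eventually_gt_atTop 0] with m hm
  have hm' : (0 : ℝ) < m := by exact_mod_cast hm
  have hW := grunwaldSum_pos h1 m
  have p1 : (0 : ℝ) < (m : ℝ) + 1 - α := by linarith
  have p3 : (0 : ℝ) < (m : ℝ) + (1 - α) / 2 := by linarith
  have b1 : 1 + (1 - α) / 2 * ((m : ℝ)⁻¹) = (m + (1 - α) / 2) / m := by field_simp
  have b2 : 1 + (1 - α) * ((m : ℝ)⁻¹) = (m + 1 - α) / m := by field_simp; ring
  have hfac : (m.factorial : ℝ) ≠ 0 := by positivity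
  have hg : Real.GammaSeq (1 - α) m = (m : ℝ) ^ (1 - α) / (grunwaldSum α m * (m + 1 - α)) := by
    rw [Real.GammaSeq, prod_one_sub_add_eq]
    field_simp
  simp only [Function.comp_apply]
  rw [b1, b2, hg, Real.log_div (by positivity) (by positivity), Real.log_mul hW.ne' p1.ne',
    Real.log_rpow hm', Real.log_div p3.ne' hm'.ne', Real.log_div p1.ne' hm'.ne', logGrunwaldSum]
  ring

/-- Second-order asymptotics of the partial sums of the Grünwald weights. -/
theorem exists_abs_grunwaldSum_sub_le {α : ℝ} (h0 : 0 < α) (h1 : α < 1) :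
    ∃ K : ℝ, 0 ≤ K ∧ ∀ m : ℕ, |Real.Gamma (1 - α) * grunwaldSum α m
        - ((m : ℝ) + (1 - α) / 2) ^ (-α)|
      ≤ K / ((m : ℝ) + (1 - α) / 2) ^ 2 * ((m : ℝ) + (1 - α) / 2) ^ (-α) := by
  have hG : 0 < Real.Gamma (1 - α) := Real.Gamma_pos_of_pos (by linarith)
  -- The value of `x = 1 / (2 * Z)` at `m = 0`, hence the largest one.
  set x₀ : ℝ := 1 / (2 - α) with hx₀
  have hx₀1 : x₀ < 1 := by rw [hx₀, div_lt_one] <;> linarith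
  have hx₀0 : 0 < x₀ := by rw [hx₀]; apply one_div_pos.2; linarith
  have hκ : 0 < 1 - x₀ ^ 2 := by nlinarith
  set K := 1 / (1 - x₀ ^ 2) with hK
  have hK0 : 0 < K := by positivity
  have key : ∀ m : ℕ, 0 ≤ logGrunwaldSum α (m + 1) - logGrunwaldSum α m ∧
      logGrunwaldSum α (m + 1) - logGrunwaldSum α m
        ≤ K / ((m : ℝ) + (1 - α) / 2) ^ 2 - K / (((m + 1 : ℕ) : ℝ) + (1 - α) / 2) ^ 2 := by
    intro m
    have hm : (0 : ℝ) ≤ m := by positivity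
    set Z : ℝ := m + 1 - α / 2 with hZ
    have hZ1 : 1 / 2 < Z := by linarith
    have hZ0 : 0 < Z := by linarith
    set x : ℝ := 1 / (2 * Z) with hx
    have hx0 : 0 < x := by positivity
    have hxx₀ : x ≤ x₀ := by
      rw [hx, hx₀]
      apply one_div_le_one_div_of_le <;> linarith
    have b := mul_log_sub_log_sub_bounds h0.le h1.le hx0.le (hxx₀.trans_lt hx₀1)
    rw [logGrunwaldSum_succ_sub h0 h1 m hx]
    refine ⟨b.1, b.2.trans ?_⟩
    have e1 : (m : ℝ) + (1 - α) / 2 = Z - 1 / 2 := by rw [hZ]; ring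
    have e2 : ((m + 1 : ℕ) : ℝ) + (1 - α) / 2 = Z + 1 / 2 := by rw [hZ]; push_cast; ring
    rw [e1, e2]
    have hs : x ^ 3 / (1 - x ^ 2) ≤ K * x ^ 3 := by
      rw [div_eq_mul_inv, mul_comm, hK, one_div]
      apply mul_le_mul_of_nonneg_right _ (by positivity)
      apply inv_anti₀ hκ
      nlinarith
    refine hs.trans ?_
    have hZm : 0 < Z - 1 / 2 := by linarith
    -- The increment, of order `Z ^ (-3)`, is dominated by a telescoping difference of inverse
    -- squares; monotone limits then sandwich the logarithm without summing a series.
    have e3 : K / (Z - 1 / 2) ^ 2 - K / (Z + 1 / 2) ^ 2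
        = K * (2 * Z / ((Z - 1 / 2) * (Z + 1 / 2)) ^ 2) := by
      have : Z + 1 / 2 ≠ 0 := by positivity
      rw [div_sub_div _ _ (pow_ne_zero 2 hZm.ne') (pow_ne_zero 2 this), ← mul_div_assoc, mul_pow]
      ring
    rw [e3]
    apply mul_le_mul_of_nonneg_left _ hK0.le
    rw [hx, div_pow, one_pow, div_le_div_iff₀ (by positivity) (by positivity)]
    have e4 : ((Z - 1 / 2) * (Z + 1 / 2)) ^ 2 ≤ (Z ^ 2) ^ 2 := by
      apply pow_le_pow_left₀ (by positivity)
      nlinarith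
    calc _ ≤ (Z ^ 2) ^ 2 := by rw [one_mul]; exact e4
      _ ≤ 16 * (Z ^ 2) ^ 2 := by nlinarith [sq_nonneg (Z ^ 2)]
      _ = _ := by ring
  have lim := tendsto_logGrunwaldSum h1
  have mono : Monotone (logGrunwaldSum α) :=
    monotone_nat_of_le_succ fun m ↦ by linarith [(key m).1]
  have upper := mono.ge_of_tendsto lim
  have anti : Antitone fun m : ℕ ↦ logGrunwaldSum α m + K / ((m : ℝ) + (1 - α) / 2) ^ 2 :=
    antitone_nat_of_succ_le fun m ↦ by linarith [(key m).2]
  have lim2 : Filter.Tendsto (fun m : ℕ ↦ logGrunwaldSum α m + K / ((m : ℝ) + (1 - α) / 2) ^ 2)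
      Filter.atTop (nhds (-Real.log (Real.Gamma (1 - α)) + 0)) := by
    apply lim.add
    apply Filter.Tendsto.const_div_atTop
    exact (Filter.tendsto_pow_atTop two_ne_zero).comp
      (Filter.tendsto_atTop_add_const_right _ _ tendsto_natCast_atTop_atTop)
  have lower := anti.le_of_tendsto lim2
  refine ⟨K, hK0.le, fun m ↦ ?_⟩
  have hX : 0 < (m : ℝ) + (1 - α) / 2 := by
    have : (0 : ℝ) ≤ m := by positivity
    linarith
  have u := upper m
  have l := lower m
  have hW := grunwaldSum_pos h1 m
  simp only [logGrunwaldSum] at u l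
  set X : ℝ := (m : ℝ) + (1 - α) / 2 with hXdef
  set V := Real.Gamma (1 - α) * grunwaldSum α m with hV
  have hVlog : Real.log V = Real.log (Real.Gamma (1 - α)) + Real.log (grunwaldSum α m) :=
    Real.log_mul hG.ne' hW.ne'
  have hVpos : 0 < V := mul_pos hG hW
  have hVexp : V = Real.exp (Real.log V + α * Real.log X) * X ^ (-α) := by
    rw [Real.rpow_def_of_pos hX, ← Real.exp_add]
    rw [show Real.log V + α * Real.log X + Real.log X * -α = Real.log V by ring,
      Real.exp_log hVpos]
  have hXp : 0 < X ^ (-α) := Real.rpow_pos_of_pos hX _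
  have up : Real.exp (Real.log V + α * Real.log X) ≤ 1 := Real.exp_le_one_iff.2 (by linarith)
  have lo : 1 - K / X ^ 2 ≤ Real.exp (Real.log V + α * Real.log X) := by
    have := Real.add_one_le_exp (Real.log V + α * Real.log X)
    linarith
  rw [hVexp, abs_le]
  constructor <;> nlinarith

/-! ### Pointwise bounds for the Peano kernels -/

/-- Second-order Taylor estimate for truncated powers. -/
theorem abs_max_rpow_sub_taylor_le {p X δ : ℝ} (hp1 : 1 ≤ p) (hp2 : p ≤ 2) (hX : 0 < X)
    (hδ : |δ| ≤ 1) :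
    |max (X + δ) 0 ^ p - X ^ p - p * δ * X ^ (p - 1)| ≤ 3 * X ^ (p - 2) := by
  have e1 : X ^ (p - 1) = X * X ^ (p - 2) := by
    nth_rewrite 2 [← Real.rpow_one X]
    rw [← Real.rpow_add hX]; congr 1; ring
  have e0 : X ^ p = X ^ 2 * X ^ (p - 2) := by
    rw [← Real.rpow_natCast, ← Real.rpow_add hX]; congr 1; push_cast; ring
  have hpos : 0 < X ^ (p - 2) := Real.rpow_pos_of_pos hX _
  rw [abs_le] at hδ
  rcases le_or_gt 0 (X + δ) with h | h
  · rw [max_eq_left h]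
    set x := δ / X with hx
    have hxX : x * X = δ := by rw [hx]; field_simp
    have hx1 : -1 ≤ x := by rw [hx, le_div_iff₀ hX]; linarith
    have e : (X + δ) ^ p = X ^ p * (1 + x) ^ p := by
      rw [← Real.mul_rpow hX.le (by linarith)]; congr 1; linear_combination -hxX
    have lo := one_add_mul_self_le_rpow_one_add hx1 hp1
    -- Bernoulli's inequality for the exponent `p - 1 ∈ [0, 1]`; with the lower bound `lo` it
    -- confines the remainder to `[0, (p - 1) * x ^ 2]`.
    have up : (1 + x) ^ p ≤ (1 + x) * (1 + (p - 1) * x) := by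
      have e2 : (1 + x) ^ p = (1 + x) * (1 + x) ^ (p - 1) := by
        rw [← Real.rpow_one_add' (by linarith) (by linarith)]; congr 1; ring
      rw [e2]
      exact mul_le_mul_of_nonneg_left
        (rpow_one_add_le_one_add_mul_self hx1 (by linarith) (by linarith)) (by linarith)
    have hmain : (X + δ) ^ p - X ^ p - p * δ * X ^ (p - 1)
        = X ^ (p - 2) * (X ^ 2 * ((1 + x) ^ p - 1 - p * x)) := by
      rw [e, e0, e1, ← hxX]; ring
    have hX2 : 0 ≤ X ^ 2 := sq_nonneg X
    have b0 : 0 ≤ X ^ 2 * ((1 + x) ^ p - 1 - p * x) := mul_nonneg hX2 (by linarith)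
    have b1 : X ^ 2 * ((1 + x) ^ p - 1 - p * x) ≤ 3 := by
      calc _ ≤ X ^ 2 * ((p - 1) * x ^ 2) := mul_le_mul_of_nonneg_left (by nlinarith) hX2
        _ = (p - 1) * δ ^ 2 := by rw [← hxX]; ring
        _ ≤ 3 := by nlinarith
    rw [hmain, abs_of_nonneg (mul_nonneg hpos.le b0), mul_comm]
    exact mul_le_mul_of_nonneg_right b1 hpos.le
  · rw [max_eq_right h.le, Real.zero_rpow (by linarith), e0, e1]
    have hX1 : X ≤ 1 := by linarith
    have b : |-(X ^ 2) - p * δ * X| ≤ 3 := by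
      rw [abs_le]
      constructor <;> nlinarith [mul_nonneg (by linarith : 0 ≤ p) (by linarith : 0 ≤ -δ)]
    calc _ = |(-(X ^ 2) - p * δ * X) * X ^ (p - 2)| := by congr 1; ring
      _ = |-(X ^ 2) - p * δ * X| * X ^ (p - 2) := by rw [abs_mul, abs_of_pos hpos]
      _ ≤ _ := mul_le_mul_of_nonneg_right b hpos.le

/-- The kernel of the interpolation error at the point `-a` between the nodes `0` and `-1`. -/
theorem abs_interpolation_kernel_le {p a τ : ℝ} (hp1 : 1 ≤ p) (hp2 : p ≤ 2) (ha0 : 0 ≤ a)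
    (ha1 : a ≤ 1) (hτ : 0 < τ) :
    |(1 - a) * max (τ - 0) 0 ^ p + a * max (τ - 1) 0 ^ p - max (τ - a) 0 ^ p|
      ≤ 6 * τ ^ (p - 2) := by
  have t1 := abs_max_rpow_sub_taylor_le hp1 hp2 hτ (δ := -1) (by norm_num)
  have t2 := abs_max_rpow_sub_taylor_le hp1 hp2 hτ (δ := -a) (by rwa [abs_neg, abs_of_nonneg ha0])
  have hpos : 0 < τ ^ (p - 2) := Real.rpow_pos_of_pos hτ _
  rw [← sub_eq_add_neg] at t1 t2
  rw [sub_zero, max_eq_left hτ.le]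
  rw [abs_le] at *
  -- In `a * t1 - t2` the zeroth-order terms match those of the kernel and the first-order terms
  -- cancel.
  constructor <;> nlinarith

/-- Truncation removes the terms with `k > τ`; the square is then expanded and the partial moments
are inserted. -/
theorem sum_grunwaldWeight_mul_max_sq {α : ℝ} (h1 : α < 1) {n : ℕ} {τ : ℝ} (hτ : 0 < τ)
    (hn : τ ≤ n) :
    ∑ k ∈ Finset.range (n + 1), grunwaldWeight α k * max (τ - k) 0 ^ (2 : ℝ)
      = grunwaldSum α ⌊τ⌋₊ * (τ ^ 2 + 2 * α * τ * ⌊τ⌋₊ / (1 - α)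
        - α * (⌊τ⌋₊ * (⌊τ⌋₊ - 1) / (2 - α) + ⌊τ⌋₊ / (1 - α))) := by
  set m := ⌊τ⌋₊ with hm
  have hmn : m ≤ n := Nat.floor_le_of_le hn
  have hsub : Finset.range (m + 1) ⊆ Finset.range (n + 1) :=
    Finset.range_subset_range.2 (by omega)
  rw [← Finset.sum_subset hsub]
  · have e : ∀ k ∈ Finset.range (m + 1), grunwaldWeight α k * max (τ - k) 0 ^ (2 : ℝ)
        = τ ^ 2 * grunwaldWeight α k - 2 * τ * (k * grunwaldWeight α k)
          + (k : ℝ) ^ 2 * grunwaldWeight α k := by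
      intro k hk
      have hk' : (k : ℝ) ≤ τ := (Nat.le_floor_iff hτ.le).1 (by rw [Finset.mem_range] at hk; omega)
      rw [max_eq_left (by linarith), Real.rpow_two]
      ring
    rw [Finset.sum_congr rfl e, Finset.sum_add_distrib, Finset.sum_sub_distrib, ← Finset.mul_sum,
      ← Finset.mul_sum, sum_mul_grunwaldWeight h1, sum_sq_mul_grunwaldWeight h1,
      ← grunwaldSum]
    ring
  · intro k _ hk
    have : τ < k := (Nat.floor_lt hτ.le).1 (by rw [Finset.mem_range] at hk; omega)
    rw [max_eq_right (by linarith), Real.zero_rpow two_ne_zero, mul_zero]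

theorem gamma_three_sub {α : ℝ} (h1 : α < 1) :
    Real.Gamma (3 - α) = (2 - α) * (1 - α) * Real.Gamma (1 - α) := by
  rw [show 3 - α = 1 - α + 1 + 1 by ring, Real.Gamma_add_one (by linarith),
    Real.Gamma_add_one (by linarith)]
  ring

set_option maxHeartbeats 800000 in
/-- The Peano kernel of the shifted Grünwald approximation decays like `τ ^ (-α)`. -/
theorem exists_abs_grunwald_kernel_le {α : ℝ} (h0 : 0 < α) (h1 : α < 1) :
    ∃ c : ℝ, 0 ≤ c ∧ ∀ (n : ℕ) (τ : ℝ), 0 < τ → τ ≤ n →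
      |(∑ k ∈ Finset.range (n + 1), grunwaldWeight α k * max (τ - k) 0 ^ (2 : ℝ)) / 2
        - max (τ - α / 2) 0 ^ (2 - α) / Real.Gamma (3 - α)| ≤ c * τ ^ (-α) := by
  obtain ⟨K, hK0, hK⟩ := exists_abs_grunwaldSum_sub_le h0 h1
  have hG : 0 < Real.Gamma (1 - α) := Real.Gamma_pos_of_pos (by linarith)
  have q1 : 0 < 1 - α := by linarith
  have q2 : 0 < 2 - α := by linarith
  set b : ℝ := (1 - α) / 2 with hb
  have hb0 : 0 < b := by positivity
  have hb1 : b < 1 := by linarith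
  set D : ℝ := 1 / ((2 - α) * (1 - α)) with hD
  have hD0 : 0 < D := by positivity
  set M : ℝ := K * (D + 1 / (1 - α) / b + 3 / b ^ 2) + 3 + 3 * D with hM
  have hM0 : 0 ≤ M := by positivity
  refine ⟨M / Real.Gamma (1 - α) * b ^ (-α), by positivity, fun n τ hτ hτn ↦ ?_⟩
  rw [sum_grunwaldWeight_mul_max_sq h1 hτ hτn, gamma_three_sub h1]
  set m := ⌊τ⌋₊ with hm
  have hm0 : (0 : ℝ) ≤ m := by positivity
  have hmτ : (m : ℝ) ≤ τ := Nat.floor_le hτ.le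
  have hτm : τ < m + 1 := Nat.lt_floor_add_one τ
  set X : ℝ := m + b with hX
  have hX0 : 0 < X := by positivity
  have hbX : b ≤ X := by linarith
  obtain ⟨θ, hθ⟩ : ∃ θ, θ = τ - m := ⟨_, rfl⟩
  have hθ0 : 0 ≤ θ := by linarith
  have hθ1 : θ < 1 := by linarith
  set δ := θ - 1 / 2 with hδ
  have hδ1 : |δ| ≤ 1 := by rw [abs_le]; constructor <;> linarith
  set W := grunwaldSum α m with hW
  obtain ⟨R, hR⟩ : ∃ R, R = ((θ - b) ^ 2 - α * (θ - b) - α * b * (b + 1) / (2 - α) + α / 2) / 2 :=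
    ⟨_, rfl⟩
  have hR3 : |R| ≤ 3 := by
    have f0 : 0 ≤ α * b * (b + 1) / (2 - α) := by positivity
    have f1 : α * b * (b + 1) / (2 - α) ≤ 2 := by
      rw [div_le_iff₀ q2]
      have : α * b ≤ 1 := by nlinarith
      have : α * b * (b + 1) ≤ 1 * (b + 1) := mul_le_mul_of_nonneg_right this (by linarith)
      linarith
    have f2 : |θ - b| ≤ 1 := by rw [abs_le]; constructor <;> linarith
    have f3 : (θ - b) ^ 2 ≤ 1 := by rw [abs_le] at f2; nlinarith
    have f4 : |α * (θ - b)| ≤ 1 := by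
      rw [abs_mul, abs_of_pos h0]
      calc _ ≤ (1 : ℝ) * 1 := mul_le_mul h1.le f2 (abs_nonneg _) zero_le_one
        _ = 1 := one_mul 1
    have f5 := sq_nonneg (θ - b)
    rw [hR]
    rw [abs_le] at *
    constructor <;> linarith
  set Q := (τ ^ 2 + 2 * α * τ * m / (1 - α) - α * (m * (m - 1) / (2 - α) + m / (1 - α))) / 2 with hQ
  -- Recentred at `X`, the quadratic has the same first two coefficients as the Taylor expansion of
  -- `D * (X + δ) ^ (2 - α)` divided by `X ^ (-α)`, and `X + δ` is exactly `τ - α / 2`. The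
  -- remainder `R` is bounded.
  have hQX : Q = D * X ^ 2 + δ * X / (1 - α) + R := by
    have e1 : τ = m + θ := by linarith
    rw [hQ, hD, hR, hδ, hX, hb, e1]
    field_simp
    ring
  have hQb : |Q| ≤ (D + 1 / (1 - α) / b + 3 / b ^ 2) * X ^ 2 := by
    have g1 : |δ * X / (1 - α)| ≤ 1 / (1 - α) / b * X ^ 2 := by
      rw [abs_div, abs_of_pos q1, abs_mul, abs_of_pos hX0]
      rw [show 1 / (1 - α) / b * X ^ 2 = (X / b) * X / (1 - α) by field_simp]
      apply div_le_div_of_nonneg_right _ q1.le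
      apply mul_le_mul_of_nonneg_right _ hX0.le
      exact hδ1.trans ((one_le_div hb0).2 hbX)
    have g2 : |R| ≤ 3 / b ^ 2 * X ^ 2 := by
      rw [div_mul_eq_mul_div, mul_div_assoc]
      have : 1 ≤ X ^ 2 / b ^ 2 := by
        rw [one_le_div (by positivity)]
        exact pow_le_pow_left₀ hb0.le hbX 2
      linarith
    rw [hQX]
    calc _ ≤ |D * X ^ 2| + |δ * X / (1 - α)| + |R| := abs_add_three _ _ _
      _ = D * X ^ 2 + |δ * X / (1 - α)| + |R| := by rw [abs_of_nonneg (by positivity)]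
      _ ≤ _ := by linarith
  have hP : 0 < X ^ (-α) := Real.rpow_pos_of_pos hX0 _
  have hT := abs_max_rpow_sub_taylor_le (p := 2 - α) (by linarith) (by linarith) hX0 hδ1
  have hXδ : X + δ = τ - α / 2 := by rw [hX, hδ, hb, hθ]; ring
  have x1 : X ^ (2 - α - 1) = X * X ^ (-α) := by
    rw [← Real.rpow_one_add' hX0.le (by linarith)]; congr 1; ring
  have x2 : X ^ (2 - α) = X ^ 2 * X ^ (-α) := by
    rw [← Real.rpow_natCast, ← Real.rpow_add hX0]; congr 1
  have x3 : (2 : ℝ) - α - 2 = -α := by ring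
  rw [hXδ, x1, x2, x3] at hT
  set Y := max (τ - α / 2) 0 ^ (2 - α) with hY
  have hKm := hK m
  have key : Real.Gamma (1 - α) * (W * Q - D * Y / Real.Gamma (1 - α))
      = (Real.Gamma (1 - α) * W - X ^ (-α)) * Q + X ^ (-α) * R
        - D * (Y - X ^ 2 * X ^ (-α) - (2 - α) * δ * (X * X ^ (-α))) := by
    rw [mul_sub, mul_div_cancel₀ _ hG.ne']
    have : X ^ (-α) * Q = X ^ (-α) * (D * X ^ 2 + δ * X / (1 - α) + R) := by rw [hQX]
    have hD2 : D * (2 - α) = 1 / (1 - α) := by rw [hD]; field_simp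
    linear_combination this - δ * X * X ^ (-α) * hD2
  have bd : Real.Gamma (1 - α) * |W * Q - D * Y / Real.Gamma (1 - α)| ≤ M * X ^ (-α) := by
    rw [← abs_of_pos hG, ← abs_mul, abs_of_pos hG, key]
    have s1 : |(Real.Gamma (1 - α) * W - X ^ (-α)) * Q|
        ≤ K * (D + 1 / (1 - α) / b + 3 / b ^ 2) * X ^ (-α) := by
      rw [abs_mul]
      calc _ ≤ (K / X ^ 2 * X ^ (-α)) * ((D + 1 / (1 - α) / b + 3 / b ^ 2) * X ^ 2) :=
            mul_le_mul hKm hQb (abs_nonneg _) (by positivity)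
        _ = _ := by field_simp
    have s2 : |X ^ (-α) * R| ≤ 3 * X ^ (-α) := by
      rw [abs_mul, abs_of_pos hP, mul_comm]
      exact mul_le_mul_of_nonneg_right hR3 hP.le
    have s3 : |D * (Y - X ^ 2 * X ^ (-α) - (2 - α) * δ * (X * X ^ (-α)))|
        ≤ 3 * D * X ^ (-α) := by
      rw [abs_mul, abs_of_pos hD0]
      calc _ ≤ D * (3 * X ^ (-α)) := mul_le_mul_of_nonneg_left hT hD0.le
        _ = _ := by ring
    calc _ ≤ _ := (abs_sub _ _).trans (add_le_add_left (abs_add_le _ _) _)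
      _ ≤ _ := add_le_add (add_le_add s1 s2) s3
      _ = _ := by rw [hM]; ring
  -- Since `b < 1` and `τ < m + 1`, one has `b * τ ≤ m + b = X`.
  have hXτ : X ^ (-α) ≤ b ^ (-α) * τ ^ (-α) := by
    rw [← Real.mul_rpow hb0.le hτ.le]
    apply Real.rpow_le_rpow_of_nonpos (by positivity) _ (by linarith)
    nlinarith
  have fin : W * (τ ^ 2 + 2 * α * τ * m / (1 - α)
      - α * (m * (m - 1) / (2 - α) + m / (1 - α))) / 2
      - Y / ((2 - α) * (1 - α) * Real.Gamma (1 - α)) = W * Q - D * Y / Real.Gamma (1 - α) := by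
    rw [hQ, hD, mul_div_assoc, div_mul_eq_mul_div, one_mul, div_div]
  rw [fin]
  rw [← le_div_iff₀' hG] at bd
  calc _ ≤ _ := bd
    _ ≤ M * (b ^ (-α) * τ ^ (-α)) / Real.Gamma (1 - α) :=
        div_le_div_of_nonneg_right (mul_le_mul_of_nonneg_left hXτ hM0) hG.le
    _ = _ := by ring

/-! ### From kernel bounds to second-order truncation errors -/

open MeasureTheory intervalIntegral in
theorem abs_integral_kernel_le {g Φ : ℝ → ℝ} {X h c M β : ℝ} (hX : 0 ≤ X) (hh : 0 < h)
    (hβ : β < 1) (hc : 0 ≤ c) (hg : ∀ s ∈ Set.Icc 0 X, |g s| ≤ M)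
    (hΦ : ∀ τ, 0 < τ → τ ≤ X / h → |Φ τ| ≤ c * τ ^ (-β)) :
    |∫ s in (0 : ℝ)..X, Φ ((X - s) / h) * g s| ≤ c * M * h ^ β * (X ^ (1 - β) / (1 - β)) := by
  have hint : IntervalIntegrable (fun s ↦ (X - s) ^ (-β)) volume 0 X := by
    have := (intervalIntegrable_rpow' (a := X) (b := 0) (r := -β) (by linarith)).comp_sub_left X
    simpa using this
  have hval : ∫ s in (0 : ℝ)..X, c * M * h ^ β * (X - s) ^ (-β)
      = c * M * h ^ β * (X ^ (1 - β) / (1 - β)) := by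
    rw [intervalIntegral.integral_const_mul,
      intervalIntegral.integral_comp_sub_left (fun t ↦ t ^ (-β)) X,
      integral_rpow (Or.inl (by linarith)), sub_self, sub_zero,
      Real.zero_rpow (by linarith), sub_zero, show -β + 1 = 1 - β by ring]
  rw [← hval, ← Real.norm_eq_abs]
  refine intervalIntegral.norm_integral_le_of_norm_le hX ?_ (hint.const_mul _)
  have hne : ∀ᵐ s : ℝ, s ≠ X := compl_mem_ae_iff.2 (measure_singleton X)
  filter_upwards [hne] with s hs hsI
  have hsX : 0 < X - s := sub_pos.2 (lt_of_le_of_ne hsI.2 hs)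
  have h1 := hΦ ((X - s) / h) (by positivity)
    (div_le_div_of_nonneg_right (by linarith [hsI.1]) hh.le)
  have h2 := hg s ⟨hsI.1.le, hsI.2⟩
  rw [Real.norm_eq_abs, abs_mul]
  have e : ((X - s) / h) ^ (-β) = (X - s) ^ (-β) * h ^ β := by
    rw [Real.div_rpow hsX.le hh.le, Real.rpow_neg hh.le, div_inv_eq_mul]
  rw [e] at h1
  have hp : 0 < (X - s) ^ (-β) * h ^ β := by positivity
  calc _ ≤ (c * ((X - s) ^ (-β) * h ^ β)) * M := mul_le_mul h1 h2 (abs_nonneg _) (by positivity)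
    _ = _ := by ring

/-- The unnormalized Riemann–Liouville integral `∫_0^x (x - s) ^ p g(s) ds`. -/
noncomputable def powerIntegral (p : ℝ) (g : ℝ → ℝ) (x : ℝ) : ℝ :=
  ∫ s in (0 : ℝ)..x, (x - s) ^ p * g s

theorem continuousOn_max_rpow_mul {g : ℝ → ℝ} {X h r p : ℝ} (hp : 0 < p)
    (hg : ContinuousOn g (Set.Icc 0 X)) :
    ContinuousOn (fun s ↦ max ((X - s) / h - r) 0 ^ p * g s) (Set.Icc 0 X) := by
  refine ContinuousOn.mul (Continuous.continuousOn ?_) hg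
  exact (by fun_prop : Continuous fun s ↦ max ((X - s) / h - r) 0).rpow_const
    fun _ ↦ Or.inr hp.le

theorem intervalIntegrable_max_rpow_mul {g : ℝ → ℝ} {X h r p : ℝ} (hX : 0 ≤ X) (hp : 0 < p)
    (hg : ContinuousOn g (Set.Icc 0 X)) :
    IntervalIntegrable (fun s ↦ max ((X - s) / h - r) 0 ^ p * g s) MeasureTheory.volume 0 X := by
  apply ContinuousOn.intervalIntegrable
  rw [Set.uIcc_of_le hX]
  exact continuousOn_max_rpow_mul hp hg

/-- Truncated powers put all delayed integrals on the common interval `[0, X]` in the variable `(X -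
s) / h`, so that linear combinations of them become a single kernel integral. -/
theorem powerIntegral_sub_eq {g : ℝ → ℝ} {X h r p : ℝ} (hh : 0 < h) (hp : 0 < p) (hr : 0 ≤ r)
    (hX : r * h ≤ X) (hg : ContinuousOn g (Set.Icc 0 X)) :
    powerIntegral p g (X - r * h)
      = h ^ p * ∫ s in (0 : ℝ)..X, max ((X - s) / h - r) 0 ^ p * g s := by
  have hrh : 0 ≤ r * h := by positivity
  have hc := continuousOn_max_rpow_mul (h := h) (r := r) hp hg
  rw [← intervalIntegral.integral_add_adjacent_intervals (b := X - r * h)]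
  · have e2 : ∫ s in (X - r * h)..X, max ((X - s) / h - r) 0 ^ p * g s = ∫ s in (X - r * h)..X, 0 := by
      apply intervalIntegral.integral_congr
      intro s hs
      rw [Set.uIcc_of_le (by linarith)] at hs
      have : (X - s) / h - r ≤ 0 := by
        rw [sub_nonpos, div_le_iff₀ hh]; linarith [hs.1]
      simp only [max_eq_right this, Real.zero_rpow hp.ne', zero_mul]
    rw [e2, intervalIntegral.integral_zero, add_zero, ← intervalIntegral.integral_const_mul,
      powerIntegral]
    apply intervalIntegral.integral_congr
    intro s hs
    rw [Set.uIcc_of_le (by linarith)] at hs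
    have h0 : 0 ≤ X - r * h - s := by linarith [hs.2]
    have e : (X - s) / h - r = (X - r * h - s) / h := by field_simp; ring
    have : 0 ≤ (X - s) / h - r := by rw [e]; positivity
    simp only
    rw [max_eq_left this, e, Real.div_rpow h0 hh.le]
    have : h ^ p ≠ 0 := (Real.rpow_pos_of_pos hh p).ne'
    field_simp
  · apply (hc.mono _).intervalIntegrable
    rw [Set.uIcc_of_le (by linarith)]
    exact Set.Icc_subset_Icc le_rfl (by linarith)
  · apply (hc.mono _).intervalIntegrable
    rw [Set.uIcc_of_le (by linarith)]
    exact Set.Icc_subset_Icc (by linarith) le_rfl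

/-- Second-order accuracy of linear interpolation for `powerIntegral p g`. -/
theorem exists_abs_interpolation_le {g : ℝ → ℝ} {T p a : ℝ} (hp1 : 1 < p) (hp2 : p ≤ 2)
    (ha0 : 0 ≤ a) (ha1 : a ≤ 1) (hg : ContinuousOn g (Set.Icc 0 T)) :
    ∃ C : ℝ, 0 ≤ C ∧ ∀ X h : ℝ, 0 < h → h ≤ X → X ≤ T →
      |(1 - a) * powerIntegral p g X + a * powerIntegral p g (X - h)
        - powerIntegral p g (X - a * h)| ≤ C * h ^ 2 := by
  rcases le_or_gt T 0 with hT | hT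
  · exact ⟨0, le_rfl, fun X h h1 h2 h3 ↦ absurd h1 (by linarith)⟩
  obtain ⟨M, hM⟩ := isCompact_Icc.exists_bound_of_continuousOn hg
  have hM0 : 0 ≤ M := (norm_nonneg _).trans (hM 0 ⟨le_rfl, hT.le⟩)
  have hp : 0 < p := by linarith
  have hp' : 0 < p - 1 := by linarith
  refine ⟨6 * M * (T ^ (p - 1) / (p - 1)), by positivity, fun X h hh hhX hXT ↦ ?_⟩
  have hX : 0 < X := by linarith
  have hgX := hg.mono (Set.Icc_subset_Icc le_rfl hXT)
  have e0 := powerIntegral_sub_eq (r := 0) hh hp le_rfl (by linarith) hgX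
  have e1 := powerIntegral_sub_eq (r := 1) hh hp zero_le_one (by linarith) hgX
  have ea := powerIntegral_sub_eq (r := a) hh hp ha0 (by nlinarith) hgX
  rw [zero_mul, sub_zero] at e0
  rw [one_mul] at e1
  have i := fun r ↦ intervalIntegrable_max_rpow_mul (h := h) (r := r) hX.le hp hgX
  have comb : (1 - a) * powerIntegral p g X + a * powerIntegral p g (X - h)
        - powerIntegral p g (X - a * h) = h ^ p * ∫ s in (0 : ℝ)..X,
          ((1 - a) * max ((X - s) / h - 0) 0 ^ p + a * max ((X - s) / h - 1) 0 ^ p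
            - max ((X - s) / h - a) 0 ^ p) * g s := by
    have : ∀ s, ((1 - a) * max ((X - s) / h - 0) 0 ^ p + a * max ((X - s) / h - 1) 0 ^ p
            - max ((X - s) / h - a) 0 ^ p) * g s
        = (1 - a) * (max ((X - s) / h - 0) 0 ^ p * g s)
          + a * (max ((X - s) / h - 1) 0 ^ p * g s) - max ((X - s) / h - a) 0 ^ p * g s :=
      fun s ↦ by ring
    simp_rw [this]
    rw [intervalIntegral.integral_sub (((i 0).const_mul _).add ((i 1).const_mul _)) (i a),
      intervalIntegral.integral_add ((i 0).const_mul _) ((i 1).const_mul _),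
      intervalIntegral.integral_const_mul, intervalIntegral.integral_const_mul, e0, e1, ea]
    ring
  have hhp : 0 < h ^ p := Real.rpow_pos_of_pos hh p
  rw [comb, abs_mul, abs_of_pos hhp]
  have b := abs_integral_kernel_le (g := g) (Φ := fun τ ↦ (1 - a) * max (τ - 0) 0 ^ p
      + a * max (τ - 1) 0 ^ p - max (τ - a) 0 ^ p) (β := 2 - p) (c := 6) (M := M) hX.le hh
      (by linarith) (by norm_num) (fun s hs ↦ hM s ⟨hs.1, hs.2.trans hXT⟩) (fun τ hτ _ ↦ by
        rw [neg_sub]; exact abs_interpolation_kernel_le hp1.le hp2 ha0 ha1 hτ)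
  have hsq : h ^ p * h ^ (2 - p) = h ^ 2 := by
    rw [← Real.rpow_add hh, ← Real.rpow_natCast]; congr 1; push_cast; ring
  have hXp : X ^ (p - 1) ≤ T ^ (p - 1) := Real.rpow_le_rpow hX.le hXT hp'.le
  rw [show 1 - (2 - p) = p - 1 by ring] at b
  calc _ ≤ h ^ p * (6 * M * h ^ (2 - p) * (X ^ (p - 1) / (p - 1))) :=
        mul_le_mul_of_nonneg_left b hhp.le
    _ = 6 * M * (X ^ (p - 1) / (p - 1)) * h ^ 2 := by rw [← hsq]; ring
    _ ≤ _ := by gcongr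

/-- Second-order accuracy of the Grünwald approximation shifted by `α / 2`. -/
theorem exists_abs_grunwald_truncation_le {g : ℝ → ℝ} {T α : ℝ} (h0 : 0 < α) (h1 : α < 1)
    (hg : ContinuousOn g (Set.Icc 0 T)) :
    ∃ C : ℝ, 0 ≤ C ∧ ∀ (n : ℕ) (h : ℝ), 0 < h → 1 ≤ n → n * h ≤ T →
      |(∑ k ∈ Finset.range (n + 1), grunwaldWeight α k * (powerIntegral 2 g (n * h - k * h) / 2))
          / h ^ α
        - powerIntegral (2 - α) g (n * h - α / 2 * h) / Real.Gamma (3 - α)| ≤ C * h ^ 2 := by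
  obtain ⟨c, hc0, hc⟩ := exists_abs_grunwald_kernel_le h0 h1
  rcases le_or_gt T 0 with hT | hT
  · refine ⟨0, le_rfl, fun n h hh hn hnT ↦ ?_⟩
    have : (1 : ℝ) ≤ n := by exact_mod_cast hn
    nlinarith
  obtain ⟨M, hM⟩ := isCompact_Icc.exists_bound_of_continuousOn hg
  have hM0 : 0 ≤ M := (norm_nonneg _).trans (hM 0 ⟨le_rfl, hT.le⟩)
  have q1 : 0 < 1 - α := by linarith
  refine ⟨c * M * (T ^ (1 - α) / (1 - α)), by positivity, fun n h hh hn hXT ↦ ?_⟩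
  have hn1 : (1 : ℝ) ≤ n := by exact_mod_cast hn
  set X : ℝ := n * h with hX
  have hX0 : 0 < X := by positivity
  have hXh : X / h = n := by rw [hX]; field_simp
  have hgX := hg.mono (Set.Icc_subset_Icc le_rfl hXT)
  have ek : ∀ k ∈ Finset.range (n + 1),
      grunwaldWeight α k * (powerIntegral 2 g (X - k * h) / 2)
        = h ^ (2 : ℝ) * ∫ s in (0 : ℝ)..X,
          grunwaldWeight α k / 2 * (max ((X - s) / h - k) 0 ^ (2 : ℝ) * g s) := by
    intro k hk
    have hkn : (k : ℝ) ≤ n := by rw [Finset.mem_range] at hk; exact_mod_cast (by omega : k ≤ n)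
    rw [powerIntegral_sub_eq hh two_pos (Nat.cast_nonneg k)
      (mul_le_mul_of_nonneg_right hkn hh.le) hgX, intervalIntegral.integral_const_mul]
    ring
  have ea := powerIntegral_sub_eq (X := X) (r := α / 2) (p := 2 - α) hh (by linarith) (by linarith)
    (mul_le_mul_of_nonneg_right (by linarith : α / 2 ≤ n) hh.le) hgX
  have i := fun r ↦ intervalIntegrable_max_rpow_mul (h := h) (r := r) hX0.le two_pos hgX
  have ia := intervalIntegrable_max_rpow_mul (h := h) (r := α / 2) (p := 2 - α) hX0.le
    (by linarith) hgX
  have hh2 : h ^ (2 : ℝ) / h ^ α = h ^ (2 - α) := (Real.rpow_sub hh _ _).symm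
  have comb : (∑ k ∈ Finset.range (n + 1), grunwaldWeight α k * (powerIntegral 2 g (X - k * h) / 2))
          / h ^ α - powerIntegral (2 - α) g (X - α / 2 * h) / Real.Gamma (3 - α)
      = h ^ (2 - α) * ∫ s in (0 : ℝ)..X, ((∑ k ∈ Finset.range (n + 1),
          grunwaldWeight α k * max ((X - s) / h - k) 0 ^ (2 : ℝ)) / 2
        - max ((X - s) / h - α / 2) 0 ^ (2 - α) / Real.Gamma (3 - α)) * g s := by
    have : ∀ s, ((∑ k ∈ Finset.range (n + 1),
          grunwaldWeight α k * max ((X - s) / h - k) 0 ^ (2 : ℝ)) / 2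
        - max ((X - s) / h - α / 2) 0 ^ (2 - α) / Real.Gamma (3 - α)) * g s
        = (∑ k ∈ Finset.range (n + 1),
          grunwaldWeight α k / 2 * (max ((X - s) / h - k) 0 ^ (2 : ℝ) * g s))
          - (1 / Real.Gamma (3 - α)) * (max ((X - s) / h - α / 2) 0 ^ (2 - α) * g s) := by
      intro s
      rw [sub_mul, Finset.sum_div, Finset.sum_mul]
      congr 1
      · exact Finset.sum_congr rfl fun k _ ↦ by ring
      · ring
    have ik : ∀ k ∈ Finset.range (n + 1), IntervalIntegrable (fun s ↦
        grunwaldWeight α k / 2 * (max ((X - s) / h - k) 0 ^ (2 : ℝ) * g s))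
        MeasureTheory.volume 0 X := fun k _ ↦ (i k).const_mul _
    have isum : IntervalIntegrable (fun s ↦ ∑ k ∈ Finset.range (n + 1),
        grunwaldWeight α k / 2 * (max ((X - s) / h - k) 0 ^ (2 : ℝ) * g s))
        MeasureTheory.volume 0 X := by
      simpa only [Finset.sum_fn] using IntervalIntegrable.sum _ ik
    simp_rw [this]
    rw [intervalIntegral.integral_sub isum (ia.const_mul _),
      intervalIntegral.integral_finsetSum ik,
      intervalIntegral.integral_const_mul, Finset.sum_congr rfl ek, ← Finset.mul_sum, ea, ← hh2]
    ring
  have hhp : 0 < h ^ (2 - α) := Real.rpow_pos_of_pos hh _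
  rw [comb, abs_mul, abs_of_pos hhp]
  have b := abs_integral_kernel_le (g := g) (Φ := fun τ ↦ (∑ k ∈ Finset.range (n + 1),
          grunwaldWeight α k * max (τ - k) 0 ^ (2 : ℝ)) / 2
        - max (τ - α / 2) 0 ^ (2 - α) / Real.Gamma (3 - α)) (β := α) hX0.le hh
      h1 hc0 (fun s hs ↦ hM s ⟨hs.1, hs.2.trans hXT⟩)
      (fun τ hτ hτn ↦ hc n τ hτ (by rwa [hXh] at hτn))
  have hsq : h ^ (2 - α) * h ^ α = h ^ 2 := by
    rw [← Real.rpow_add hh, ← Real.rpow_natCast]; congr 1; push_cast; ring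
  have hXp : X ^ (1 - α) ≤ T ^ (1 - α) := Real.rpow_le_rpow hX0.le hXT q1.le
  calc _ ≤ h ^ (2 - α) * (c * M * h ^ α * (X ^ (1 - α) / (1 - α))) :=
        mul_le_mul_of_nonneg_left b hhp.le
    _ = c * M * (X ^ (1 - α) / (1 - α)) * h ^ 2 := by rw [← hsq]; ring
    _ ≤ _ := by gcongr

/-! ### Integral representation of the solution -/

-- Integration by parts: one boundary term vanishes because `G 0 = 0`, the other because `q + 1 >
-- 0`. The condition `-1 < q` admits the singular Caputo kernel `q = -α`.
open MeasureTheory in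
theorem powerIntegral_eq_of_hasDerivAt {G g : ℝ → ℝ} {q x : ℝ} (hq : -1 < q) (hx : 0 ≤ x)
    (hG : ContinuousOn G (Set.Icc 0 x)) (hg : ContinuousOn g (Set.Icc 0 x)) (hG0 : G 0 = 0)
    (hd : ∀ s ∈ Set.Ioo 0 x, HasDerivAt G (g s) s) :
    powerIntegral q G x = powerIntegral (q + 1) g x / (q + 1) := by
  have hq1 : 0 < q + 1 := by linarith
  have hint : IntervalIntegrable (fun s ↦ (x - s) ^ q) volume 0 x := by
    have := (intervalIntegral.intervalIntegrable_rpow' (a := x) (b := 0) hq).comp_sub_left x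
    simpa using this
  have parts := intervalIntegral.integral_mul_deriv_eq_deriv_mul_of_hasDerivAt (a := 0) (b := x)
    (u := G) (u' := g) (v := fun s ↦ -((x - s) ^ (q + 1) / (q + 1))) (v' := fun s ↦ (x - s) ^ q)
    (by rwa [Set.uIcc_of_le hx])
    (Continuous.continuousOn (((by fun_prop : Continuous fun s ↦ x - s).rpow_const
      fun _ ↦ Or.inr hq1.le).div_const _).neg)
    (by rwa [min_eq_left hx, max_eq_right hx])
    (by
      rw [min_eq_left hx, max_eq_right hx]
      intro s hs
      have := (((hasDerivAt_id s).const_sub x).rpow_const (p := q + 1)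
        (Or.inl (sub_pos.2 hs.2).ne')).div_const (q + 1) |>.neg
      refine this.congr_deriv ?_
      rw [add_sub_cancel_right, id]
      field_simp)
    (ContinuousOn.intervalIntegrable (by rwa [Set.uIcc_of_le hx])) hint
  have l : powerIntegral q G x = ∫ s in (0 : ℝ)..x, G s * (x - s) ^ q := by
    rw [powerIntegral]; simp_rw [mul_comm]
  rw [l, parts, hG0, sub_self, Real.zero_rpow hq1.ne', powerIntegral,
    ← intervalIntegral.integral_div]
  simp only [zero_div, neg_zero, mul_zero, zero_mul, sub_zero, zero_sub]
  rw [← intervalIntegral.integral_neg]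
  congr 1
  ext s
  ring

open MeasureTheory in
/-- Integral representation of a function of class `C^3` vanishing to second order at `0`, and of
its Caputo derivative. -/
theorem exists_powerIntegral_representation {α T : ℝ} (h1 : α < 1) (hT : 0 < T)
    {y : ℝ → ℝ} (hy : ContDiffOn ℝ 3 y (Set.Icc 0 T)) (hy0 : y 0 = 0)
    (hy1 : iteratedDerivWithin 1 y (Set.Icc 0 T) 0 = 0)
    (hy2 : iteratedDerivWithin 2 y (Set.Icc 0 T) 0 = 0) :
    ∃ g : ℝ → ℝ, ContinuousOn g (Set.Icc 0 T) ∧ ∀ x ∈ Set.Icc 0 T,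
      y x = powerIntegral 2 g x / 2 ∧
      caputoDeriv 0 α y x = powerIntegral (2 - α) g x / Real.Gamma (3 - α) := by
  have hu : UniqueDiffOn ℝ (Set.Icc 0 T) := uniqueDiffOn_Icc hT
  set y1 := derivWithin y (Set.Icc 0 T) with hy1def
  set y2 := derivWithin y1 (Set.Icc 0 T) with hy2def
  set g := derivWithin y2 (Set.Icc 0 T) with hgdef
  have c1 : ContDiffOn ℝ 2 y1 (Set.Icc 0 T) := hy.derivWithin hu (by norm_num)
  have c2 : ContDiffOn ℝ 1 y2 (Set.Icc 0 T) := c1.derivWithin hu (by norm_num)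
  have c3 : ContDiffOn ℝ 0 g (Set.Icc 0 T) := c2.derivWithin hu (by norm_num)
  rw [iteratedDerivWithin_one] at hy1
  rw [iteratedDerivWithin_succ, iteratedDerivWithin_one] at hy2
  have hd : ∀ {F : ℝ → ℝ}, DifferentiableOn ℝ F (Set.Icc 0 T) → ∀ s ∈ Set.Ioo 0 T,
      HasDerivAt F (derivWithin F (Set.Icc 0 T) s) s := fun hF s hs ↦
    (hF s (Set.Ioo_subset_Icc_self hs)).hasDerivWithinAt.hasDerivAt (Icc_mem_nhds hs.1 hs.2)
  have d0 := hd (hy.differentiableOn (by norm_num))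
  have d1 := hd (c1.differentiableOn (by norm_num))
  have d2 := hd (c2.differentiableOn (by norm_num))
  refine ⟨g, c3.continuousOn, fun x hx ↦ ?_⟩
  have sI : Set.Icc 0 x ⊆ Set.Icc 0 T := Set.Icc_subset_Icc le_rfl hx.2
  have sO : Set.Ioo 0 x ⊆ Set.Ioo 0 T := Set.Ioo_subset_Ioo le_rfl hx.2
  have step1 : ∀ q : ℝ, -1 < q → powerIntegral q y1 x = powerIntegral (q + 1) y2 x / (q + 1) :=
    fun q hq ↦ powerIntegral_eq_of_hasDerivAt hq hx.1 (c1.continuousOn.mono sI)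
      (c2.continuousOn.mono sI) hy1 fun s hs ↦ d1 s (sO hs)
  have step2 : ∀ q : ℝ, -1 < q → powerIntegral q y2 x = powerIntegral (q + 1) g x / (q + 1) :=
    fun q hq ↦ powerIntegral_eq_of_hasDerivAt hq hx.1 (c2.continuousOn.mono sI)
      (c3.continuousOn.mono sI) hy2 fun s hs ↦ d2 s (sO hs)
  constructor
  · have ftc : ∫ s in (0 : ℝ)..x, y1 s = y x - y 0 :=
      intervalIntegral.integral_eq_sub_of_hasDerivAt_of_le hx.1 (hy.continuousOn.mono sI)
        (fun s hs ↦ d0 s (sO hs))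
        (ContinuousOn.intervalIntegrable (by
          rw [Set.uIcc_of_le hx.1]; exact c1.continuousOn.mono sI))
    have e : powerIntegral 0 y1 x = y x := by
      simp only [powerIntegral, Real.rpow_zero, one_mul]
      rw [ftc, hy0, sub_zero]
    rw [← e, step1 0 (by norm_num), step2 (0 + 1) (by norm_num)]
    norm_num
  · have e : ∫ ξ in (0 : ℝ)..x, deriv y ξ / (x - ξ) ^ α = powerIntegral (-α) y1 x := by
      rw [powerIntegral]
      apply intervalIntegral.integral_congr_ae
      have hne : ∀ᵐ s : ℝ, s ≠ x := compl_mem_ae_iff.2 (measure_singleton x)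
      filter_upwards [hne] with s hs hsI
      rw [Set.uIoc_of_le hx.1] at hsI
      have hsx : s < x := lt_of_le_of_ne hsI.2 hs
      rw [(d0 s (sO ⟨hsI.1, hsx⟩)).deriv, Real.rpow_neg (by linarith), div_eq_mul_inv, mul_comm]
    have n1 : 1 - α ≠ 0 := by linarith
    have n2 : 2 - α ≠ 0 := by linarith
    rw [caputoDeriv, e, step1 (-α) (by linarith), step2 (-α + 1) (by linarith),
      gamma_three_sub h1, show -α + 1 + 1 = 2 - α by ring, show -α + 1 = 1 - α by ring]
    field_simp

/-! ### Convergence of the two schemes -/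

/-- The error solves the same recurrence, with the residual of the exact values as source. Leaving
`F` arbitrary covers both schemes. -/
theorem abs_sub_le_of_grunwald_scheme {α H ε : ℝ} (h0 : 0 < α) (h1 : α < 1) (hH : 0 < H)
    (hε : 0 ≤ ε) {N : ℕ} {Y u F : ℕ → ℝ} (hY0 : Y 0 = 0) (hu0 : u 0 = 0)
    (hu : ∀ n, 1 ≤ n → n ≤ N → u n = 1 / (1 + (1 - α / 2) * H) *
      (H * F n + α / 2 * (2 - H) * u (n - 1)
        - ∑ k ∈ Finset.Icc 2 n, grunwaldWeight α k * u (n - k)))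
    (hY : ∀ n, 1 ≤ n → n ≤ N →
      |(∑ k ∈ Finset.range (n + 1), grunwaldWeight α k * Y (n - k)) / H
        + ((1 - α / 2) * Y n + α / 2 * Y (n - 1)) - F n| ≤ ε)
    (n : ℕ) (hn : n ≤ N) : |Y n - u n| ≤ ε / (1 - α) := by
  refine abs_le_of_grunwald_recurrence (e := fun n ↦ Y n - u n) h0 h1 hH hε
    (by simp [hY0, hu0]) hY (fun n hn1 hnN ↦ ?_) n hn
  have hc : 0 < 1 + (1 - α / 2) * H := by nlinarith
  have eu : (1 + (1 - α / 2) * H) * u n = H * F n + α / 2 * (2 - H) * u (n - 1)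
        - ∑ k ∈ Finset.Icc 2 n, grunwaldWeight α k * u (n - k) := by
    rw [hu n hn1 hnN, ← mul_assoc, mul_one_div_cancel hc.ne', one_mul]
  have es := sum_grunwaldWeight_mul_eq (α := α) hn1 fun k ↦ Y (n - k)
  simp only [Nat.sub_zero] at es
  simp only [mul_sub, Finset.sum_sub_distrib]
  rw [eu, es, mul_add, mul_div_cancel₀ _ hH.ne']
  ring

theorem theorem7 (α T : ℝ) (hα0 : 0 < α) (hα1 : α < 1) (hT : 0 < T) (f y : ℝ → ℝ)
    (hsol : IsFracSolution α T f y)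
    (hy : ContDiffOn ℝ 3 y (Set.Icc 0 T))
    (hy0 : y 0 = 0)
    (hy1 : iteratedDerivWithin 1 y (Set.Icc 0 T) 0 = 0)
    (hy2 : iteratedDerivWithin 2 y (Set.Icc 0 T) 0 = 0) :
    ∃ C : ℝ, ∀ (N : ℕ), 1 ≤ N → ∀ h : ℝ, h = T / (N : ℝ) →
      (∀ u : ℕ → ℝ, IsMidpointScheme α h f N u →
        ∀ n : ℕ, n ≤ N → |y ((n : ℝ) * h) - u n| ≤ C * h ^ 2) ∧
      (∀ u : ℕ → ℝ, IsAverageScheme α h f N u →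
        ∀ n : ℕ, n ≤ N → |y ((n : ℝ) * h) - u n| ≤ C * h ^ 2) := by
  obtain ⟨g, hg, hrep⟩ := exists_powerIntegral_representation hα1 hT hy hy0 hy1 hy2
  obtain ⟨C₁, hC₁, b₁⟩ := exists_abs_grunwald_truncation_le hα0 hα1 hg
  obtain ⟨C₂, hC₂, b₂⟩ := exists_abs_interpolation_le (p := 2) (a := α / 2) one_lt_two le_rfl
    (by linarith) (by linarith) hg
  obtain ⟨C₃, hC₃, b₃⟩ := exists_abs_interpolation_le (p := 2 - α) (a := α / 2) (by linarith)
    (by linarith) (by linarith) (by linarith) hg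
  have hΓ : 0 < Real.Gamma (3 - α) := Real.Gamma_pos_of_pos (by linarith)
  have h1α : 0 < 1 - α := by linarith
  set C := C₁ + C₂ / 2 + C₃ / Real.Gamma (3 - α) with hC
  have hC0 : 0 ≤ C := by positivity
  refine ⟨C / (1 - α), fun N hN h hh ↦ ?_⟩
  have hN0 : (0 : ℝ) < N := by exact_mod_cast hN
  have hpos : 0 < h := by rw [hh]; positivity
  have hNh : N * h = T := by rw [hh]; field_simp
  have hH : 0 < h ^ α := Real.rpow_pos_of_pos hpos α
  have hε : 0 ≤ C * h ^ 2 := by positivity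
  have mem : ∀ t : ℝ, 0 ≤ t → t ≤ N → t * h ∈ Set.Icc 0 T := fun t ht htN ↦
    ⟨by positivity, by rw [← hNh]; exact mul_le_mul_of_nonneg_right htN hpos.le⟩
  have hf : ∀ t : ℝ, 0 ≤ t → t ≤ N → f (t * h)
      = powerIntegral (2 - α) g (t * h) / Real.Gamma (3 - α) + powerIntegral 2 g (t * h) / 2 := by
    intro t ht htN
    rw [← hsol _ (mem t ht htN), (hrep _ (mem t ht htN)).2, (hrep _ (mem t ht htN)).1]
  have hgrid : ∀ n k : ℕ, k ≤ n → n ≤ N →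
      y (((n - k : ℕ) : ℝ) * h) = powerIntegral 2 g (n * h - k * h) / 2 := by
    intro n k hk hn
    rw [(hrep _ (mem _ (by positivity) (by exact_mod_cast (by omega : n - k ≤ N)))).1,
      Nat.cast_sub hk, sub_mul]
  -- Three comparisons at the shifted point: Grünwald quotient, interpolation of `y`, interpolation
  -- of the Caputo derivative. The first scheme uses the first two, the second scheme the first and
  -- third.
  have local_error : ∀ n : ℕ, 1 ≤ n → n ≤ N →
      |(∑ k ∈ Finset.range (n + 1), grunwaldWeight α k * y (((n - k : ℕ) : ℝ) * h)) / h ^ α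
        - powerIntegral (2 - α) g ((n - α / 2) * h) / Real.Gamma (3 - α)| ≤ C₁ * h ^ 2 ∧
      |(1 - α / 2) * y (n * h) + α / 2 * y (((n - 1 : ℕ) : ℝ) * h)
        - powerIntegral 2 g ((n - α / 2) * h) / 2| ≤ C₂ / 2 * h ^ 2 ∧
      |(1 - α / 2) * (powerIntegral (2 - α) g (n * h) / Real.Gamma (3 - α))
        + α / 2 * (powerIntegral (2 - α) g ((n - 1) * h) / Real.Gamma (3 - α))
        - powerIntegral (2 - α) g ((n - α / 2) * h) / Real.Gamma (3 - α)|
          ≤ C₃ / Real.Gamma (3 - α) * h ^ 2 := by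
    intro n hn hnN
    have hn1 : (1 : ℝ) ≤ n := by exact_mod_cast hn
    have hnN' : (n : ℝ) ≤ N := by exact_mod_cast hnN
    have hmem := mem n (by positivity) hnN'
    have hle : h ≤ n * h := le_mul_of_one_le_left hpos.le hn1
    have c₁ := b₁ n h hpos hn hmem.2
    have c₂ := b₂ (n * h) h hpos hle hmem.2
    have c₃ := b₃ (n * h) h hpos hle hmem.2
    have hy_n := hgrid n 0 (Nat.zero_le n) hnN
    rw [Nat.sub_zero, Nat.cast_zero, zero_mul, sub_zero] at hy_n
    have hy_pred := hgrid n 1 hn hnN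
    rw [Nat.cast_one, one_mul] at hy_pred
    rw [← sub_mul] at c₁ c₂ c₃
    refine ⟨?_, ?_, ?_⟩
    · rw [Finset.sum_congr rfl fun k hk ↦ by
        rw [hgrid n k (by rw [Finset.mem_range] at hk; omega) hnN]]
      exact c₁
    · rw [hy_n, hy_pred]
      rw [abs_le] at c₂ ⊢
      constructor <;> linarith
    · rw [sub_one_mul, ← mul_div_assoc, ← mul_div_assoc (α / 2), ← add_div, ← sub_div, abs_div,
        abs_of_pos hΓ, div_mul_eq_mul_div C₃]
      exact div_le_div_of_nonneg_right c₃ hΓ.le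
  have hΓ₃ : 0 ≤ C₃ / Real.Gamma (3 - α) * h ^ 2 := by positivity
  have hsplit : C * h ^ 2 = C₁ * h ^ 2 + C₂ / 2 * h ^ 2 + C₃ / Real.Gamma (3 - α) * h ^ 2 := by
    rw [hC]; ring
  have hy00 : y (((0 : ℕ) : ℝ) * h) = 0 := by simpa using hy0
  rw [div_mul_eq_mul_div]
  constructor
  · rintro u ⟨hu0, hu⟩
    refine abs_sub_le_of_grunwald_scheme (Y := fun n : ℕ ↦ y (n * h))
      (F := fun n : ℕ ↦ f ((n - α / 2) * h)) hα0 hα1 hH hε hy00 hu0 hu fun n hn hnN ↦ ?_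
    obtain ⟨l₁, l₂, -⟩ := local_error n hn hnN
    have hn1 : (1 : ℝ) ≤ n := by exact_mod_cast hn
    have hnN' : (n : ℝ) ≤ N := by exact_mod_cast hnN
    rw [hf _ (by linarith) (by linarith)]
    rw [abs_le] at *
    constructor <;> linarith
  · rintro u ⟨hu0, hu⟩
    refine abs_sub_le_of_grunwald_scheme (Y := fun n : ℕ ↦ y (n * h))
      (F := fun n : ℕ ↦ (1 - α / 2) * f (n * h) + α / 2 * f ((n - 1) * h))
      hα0 hα1 hH hε hy00 hu0 hu fun n hn hnN ↦ ?_
    obtain ⟨l₁, -, l₃⟩ := local_error n hn hnN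
    have hn1 : (1 : ℝ) ≤ n := by exact_mod_cast hn
    have hnN' : (n : ℝ) ≤ N := by exact_mod_cast hnN
    have hyn := (hrep _ (mem n (by linarith) hnN')).1
    have hyp := (hrep _ (mem (n - 1) (by linarith) (by linarith))).1
    have hC₂h : 0 ≤ C₂ / 2 * h ^ 2 := by positivity
    -- Averaging `f` reproduces the averaged `y` of the scheme exactly, so only the Caputo part is
    -- interpolated.
    rw [hf _ (by linarith) hnN', hf _ (by linarith) (by linarith), ← hyn, ← hyp]
    simp only [Nat.cast_sub hn, Nat.cast_one]
    rw [abs_le] at *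
    constructor <;> linarith
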